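/- Let $X$ be a real reflexive Banach space, and let $Z \neq \{0\}$ be a real Hausdorff locally convex topological vector space. Let $C \subseteq Z$ be a convex cone ($tc \in C$ for $c\in C$, $t \ge 0$, and $C + C = C$) which is pointed ($C \cap (-C) = \{0\}$) and has nonempty interior $\operatorname{int} C$. Let $K \subseteq X$ be nonempty, convex and closed, and let $D \subseteq K$ be self segment-dense in $K$ for the weak topology of $X$; that is, $D$ is weakly dense in $K$ and, for all $x, y \in D$, the set $[x,y] \cap D$ is weakly dense in the segment $[x,y]$. A map $G : K \to Z$ is called $C$-upper semicontinuous at $x \in K$ if for every neighbourhood $V$ of $G(x)$ there is a neighbourhood $U$ of $x$ with $G(u) \in V - C$ for all $u \in U \cap K$, and $C$-lower semicontinuous at $x$ if $-G$ is $C$-upper semicontinuous at $x$. Here neighbourhoods of $x$ are taken in the norm topology of $X$ (so the result covers in particular maps that are $C$-semicontinuous for the weak topology). Let $F : K \to Z$ satisfy: (i) $F$ is $C$-lower semicontinuous at every point of $K$; (ii) $F$ is $C$-upper semicontinuous at every point of $K \setminus D$; (iii) $F$ is $C$-convex on $D$: for all $x_1,\dots,x_n \in D$ and $\lambda_1,\dots,\lambda_n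 \ge 0$ with $\sum_{i} \lambda_i = 1$ and $\sum_i \lambda_i x_i \in D$, one has $\sum_i \lambda_i F(x_i) - F\big(\sum_i \lambda_i x_i\big) \in C$; (iv) there is $r > 0$ such that $\{x \in K : \|x\| \le r\}$ is nonempty and for every $x \in K$ with $\|x\| \le r$ there is $y_0 \in D$ with $\|y_0\| < r$ and $F(y_0) - F(x) \in -\operatorname{int} C \cup \{0\}$. Then $F$ has a weakly efficient point: there is $x_0 \in K$ such that $F(y) - F(x_0) \notin -\operatorname{int} C$ for all $y \in K$. -/

import Mathlib

open scoped Pointwise Topology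

/-- A real normed space is reflexive if the canonical map into its bidual is onto. -/
def IsReflexiveSpace (X : Type*) [NormedAddCommGroup X] [NormedSpace ℝ X] : Prop :=
  Function.Surjective (NormedSpace.inclusionInDoubleDual ℝ X)

/-- `U` is self segment-dense in the convex set `V`: `U ⊆ V`, `U` is dense in `V`, and for all
`x, y ∈ U` the set `[x, y] ∩ U` is dense in the closed segment `[x, y]`. -/
structure IsSelfSegmentDense {E : Type*} [AddCommGroup E] [Module ℝ E] [TopologicalSpace E]
    (U V : Set E) : Prop where
  convex : Convex ℝ V
  subset : U ⊆ V
  dense : V ⊆ closure U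
  segment_dense : ∀ x ∈ U, ∀ y ∈ U, segment ℝ x y ⊆ closure (segment ℝ x y ∩ U)

/-- Self segment-density with respect to the weak topology of the normed space `X`. -/
def IsWeaklySelfSegmentDense {X : Type*} [NormedAddCommGroup X] [NormedSpace ℝ X]
    (U V : Set X) : Prop :=
  IsSelfSegmentDense (toWeakSpace ℝ X '' U) (toWeakSpace ℝ X '' V)

section Cone

variable {X Z : Type*} [AddCommGroup Z] [Module ℝ Z] [TopologicalSpace Z]

/-- `F : K → Z` (given by a function on `X`, only its values on `K` matter) is `C`-upper
semicontinuous at `x`: for every neighbourhood `V` of `F x` there is a neighbourhood `U` of `x`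
with `F u ∈ V - C` for all `u ∈ U ∩ K`. -/
def ConeUpperSemicontinuousAt [TopologicalSpace X] (C : PointedCone ℝ Z) (K : Set X)
    (F : X → Z) (x : X) : Prop :=
  ∀ V ∈ 𝓝 (F x), ∃ U ∈ 𝓝 x, ∀ u ∈ U ∩ K, F u ∈ V - (C : Set Z)

/-- `F : K → Z` is `C`-lower semicontinuous at `x` if `-F` is `C`-upper semicontinuous at `x`. -/
def ConeLowerSemicontinuousAt [TopologicalSpace X] (C : PointedCone ℝ Z) (K : Set X)
    (F : X → Z) (x : X) : Prop :=
  ConeUpperSemicontinuousAt C K (fun u => -F u) x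

/-- `F` is `C`-convex on the (not necessarily convex) set `D`: whenever a convex combination
`∑ i, t i • x i` of points of `D` again lies in `D`, one has
`F (∑ i, t i • x i) ≤ ∑ i, t i • F (x i)` in the order induced by `C`. -/
def ConeConvexOn [AddCommGroup X] [Module ℝ X] (C : PointedCone ℝ Z) (D : Set X)
    (F : X → Z) : Prop :=
  ∀ (n : ℕ) (x : Fin n → X) (t : Fin n → ℝ), (∀ i, x i ∈ D) → (∀ i, 0 ≤ t i) →
    ∑ i, t i = 1 → ∑ i, t i • x i ∈ D →
      (∑ i, t i • F (x i)) - F (∑ i, t i • x i) ∈ C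

/-- `x₀` is a weakly efficient point of `F : K → Z`:
`x₀ ∈ K` and `F y - F x₀ ∉ -int C` for all `y ∈ K`. -/
def IsWeaklyEfficientPoint (C : PointedCone ℝ Z) (K : Set X) (F : X → Z) (x₀ : X) : Prop :=
  x₀ ∈ K ∧ ∀ y ∈ K, F y - F x₀ ∉ -interior (C : Set Z)

end Cone

open Set Filter Metric

/-! The problem is scalarized. Pointedness and `Z ≠ 0` keep `0` out of `int C`, so Hahn-Banach gives
a continuous linear `g`, nonnegative on `C` and positive on `int C`; any minimizer of `f = g ∘ F` on
`K` is then weakly efficient.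

The main point is that `f` is convex on all of `K` (`IsWeaklySelfSegmentDense.convexOn`). On a
segment the weak and norm topologies agree, so parameters of points of `D` are dense there; hence
the norm closure of `D` is convex, and by Mazur `D` is norm dense in `K`. Since `f` is continuous
off `D`, its graph lies in the closure of its graph over `D`, and convexity passes to the limit in
the closed epigraph.

Reflexivity gives a minimizer `x₀` of `f` on `K ∩ closedBall 0 r`. Condition (iv) gives a point `y₀`
of the open ball with no larger value: a local, hence by convexity global, minimizer on `K`. -/

/-- A real affine functional separating `x` from `y` parametrizes the segment `[x, y]`, so weak
density of a subset of the segment gives density of the corresponding set of parameters. -/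
theorem mem_closure_parameters {X : Type*} [NormedAddCommGroup X] [NormedSpace ℝ X]
    {U V : Set X} (h : IsWeaklySelfSegmentDense U V) {x y : X} (hx : x ∈ U) (hy : y ∈ U)
    {t : ℝ} (ht : t ∈ Icc (0 : ℝ) 1) :
    t ∈ closure {s : ℝ | s ∈ Icc (0 : ℝ) 1 ∧ AffineMap.lineMap x y s ∈ U} := by
  rcases eq_or_ne x y with rfl | hne
  · exact subset_closure ⟨ht, by simpa using hx⟩
  obtain ⟨g, hg⟩ := SeparatingDual.exists_eq_one (R := ℝ) (sub_ne_zero.2 hne.symm)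
  have hpar : ∀ s : ℝ, g (AffineMap.lineMap x y s) - g x = s := fun s => by
    rw [AffineMap.lineMap_apply_module', map_add, map_smul, hg]
    simp
  have hcont : Continuous fun z : WeakSpace ℝ X => g ((toWeakSpace ℝ X).symm z) - g x :=
    (WeakBilin.eval_continuous (topDualPairing ℝ X).flip g).sub continuous_const
  have hseg : segment ℝ (toWeakSpace ℝ X x) (toWeakSpace ℝ X y) =
      toWeakSpace ℝ X '' segment ℝ x y :=
    (image_segment ℝ (toWeakSpace ℝ X).toLinearMap.toAffineMap x y).symm
  have hmem : toWeakSpace ℝ X (AffineMap.lineMap x y t) ∈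
      segment ℝ (toWeakSpace ℝ X x) (toWeakSpace ℝ X y) := by
    rw [hseg, segment_eq_image_lineMap]
    refine mem_image_of_mem _ ?_
    exact mem_image_of_mem _ ht
  have hcl := h.segment_dense _ (mem_image_of_mem _ hx) _ (mem_image_of_mem _ hy) hmem
  have himg := image_closure_subset_closure_image hcont (mem_image_of_mem _ hcl)
  simp only [LinearEquiv.symm_apply_apply, hpar] at himg
  refine closure_mono ?_ himg
  rintro _ ⟨z, ⟨hz, w, hw, rfl⟩, rfl⟩
  rw [hseg, (toWeakSpace ℝ X).injective.mem_set_image, segment_eq_image_lineMap] at hz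
  obtain ⟨s, hs, rfl⟩ := hz
  simp only [LinearEquiv.symm_apply_apply, hpar]
  exact ⟨hs, hw⟩

/-- The norm closure of a weakly self segment-dense set is convex. -/
theorem IsWeaklySelfSegmentDense.convex_closure {X : Type*} [NormedAddCommGroup X]
    [NormedSpace ℝ X] {U V : Set X} (h : IsWeaklySelfSegmentDense U V) :
    Convex ℝ (closure U) := by
  intro x hx y hy a b ha hb hab
  rw [← closure_closure (s := U)]
  have hcont : Continuous (Function.uncurry fun u v : X => a • u + b • v) := by
    unfold Function.uncurry
    fun_prop
  refine map_mem_closure₂ (f := fun u v : X => a • u + b • v) hcont hx hy fun u hu v hv => ?_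
  have hc : Continuous fun s : ℝ => (AffineMap.lineMap u v s : X) := by fun_prop
  have hb' := mem_closure_parameters h hu hv (t := b) ⟨hb, by linarith⟩
  have := map_mem_closure hc hb' (t := U) fun s hs => hs.2
  rwa [AffineMap.lineMap_apply_module, show 1 - b = a by linarith] at this

/-- A weakly self segment-dense subset is norm dense. -/
theorem IsWeaklySelfSegmentDense.subset_closure {X : Type*} [NormedAddCommGroup X]
    [NormedSpace ℝ X] {U V : Set X} (h : IsWeaklySelfSegmentDense U V) : V ⊆ closure U := by
  intro x hx
  have h1 := h.dense (mem_image_of_mem _ hx)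
  have h2 := closure_mono (image_mono (f := toWeakSpace ℝ X) (_root_.subset_closure (s := U))) h1
  -- Mazur: the norm closure of `U` is convex, hence weakly closed.
  rw [← h.convex_closure.toWeakSpace_closure ℝ, closure_closure] at h2
  exact (toWeakSpace ℝ X).injective.mem_set_image.1 h2

theorem IsWeaklySelfSegmentDense.subset {X : Type*} [NormedAddCommGroup X]
    [NormedSpace ℝ X] {U V : Set X} (h : IsWeaklySelfSegmentDense U V) : U ⊆ V :=
  (image_subset_image_iff (toWeakSpace ℝ X).injective).1 (IsSelfSegmentDense.subset h)

/-- A lower semicontinuous real function which is convex on a weakly self segment-dense subset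
and upper semicontinuous off it is convex. -/
theorem IsWeaklySelfSegmentDense.convexOn {X : Type*} [NormedAddCommGroup X] [NormedSpace ℝ X]
    {D K : Set X} (h : IsWeaklySelfSegmentDense D K) (hKconv : Convex ℝ K) (hK : IsClosed K)
    {f : X → ℝ} (hlsc : LowerSemicontinuousOn f K)
    (husc : ∀ x ∈ K \ D, UpperSemicontinuousWithinAt f K x)
    (hconv : ∀ x ∈ D, ∀ y ∈ D, ∀ s ∈ Icc (0 : ℝ) 1, AffineMap.lineMap x y s ∈ D →
      f (AffineMap.lineMap x y s) ≤ AffineMap.lineMap (f x) (f y) s) :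
    ConvexOn ℝ K f := by
  have hepi := (lowerSemicontinuousOn_iff_isClosed_epigraph hK).1 hlsc
  have hgraph : ∀ x ∈ K, (x, f x) ∈ closure ((fun u => (u, f u)) '' D) := by
    intro x hx
    by_cases hxD : x ∈ D
    · exact _root_.subset_closure (mem_image_of_mem _ hxD)
    have hc : ContinuousWithinAt f K x :=
      continuousWithinAt_iff_lower_upperSemicontinuousWithinAt.2 ⟨hlsc x hx, husc x ⟨hx, hxD⟩⟩
    have hc' : ContinuousWithinAt (fun u => (u, f u)) D x :=
      continuousWithinAt_id.prodMk (hc.mono h.subset)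
    exact hc'.mem_closure_image (h.subset_closure hx)
  refine ⟨hKconv, fun x hx y hy a b ha hb hab => ?_⟩
  have hcont : Continuous (Function.uncurry fun p q : X × ℝ => a • p + b • q) := by
    unfold Function.uncurry
    fun_prop
  -- Two limits are taken inside the closed epigraph: first the endpoints are approached by graph
  -- points over `D`, then the weight `b` by parameters whose points lie in `D`.
  suffices hmem : a • (x, f x) + b • (y, f y) ∈ closure {p : X × ℝ | p.1 ∈ K ∧ f p.1 ≤ p.2} by
    rw [hepi.closure_eq] at hmem
    exact hmem.2
  refine map_mem_closure₂ (f := fun p q : X × ℝ => a • p + b • q) hcont (hgraph x hx) (hgraph y hy) ?_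
  rintro _ ⟨u, hu, rfl⟩ _ ⟨v, hv, rfl⟩
  have hc : Continuous fun s : ℝ =>
      ((AffineMap.lineMap u v s : X), (AffineMap.lineMap (f u) (f v) s : ℝ)) := by fun_prop
  have hb' := mem_closure_parameters h hu hv (t := b) ⟨hb, by linarith⟩
  have := map_mem_closure hc hb' (t := {p : X × ℝ | p.1 ∈ K ∧ f p.1 ≤ p.2})
    fun s hs => ⟨h.subset hs.2, hconv u hu v hv s hs.1 hs.2⟩
  rw [hepi.closure_eq] at this
  rwa [AffineMap.lineMap_apply_module, AffineMap.lineMap_apply_module,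
    show 1 - b = a by linarith] at this

/-- Bounded closed convex subsets of a reflexive space are weakly compact. -/
theorem IsReflexiveSpace.isCompact_toWeakSpace_image {X : Type*} [NormedAddCommGroup X]
    [NormedSpace ℝ X] (hX : IsReflexiveSpace X) {S : Set X} (hS : Convex ℝ S) (hc : IsClosed S)
    (hb : Bornology.IsBounded S) : IsCompact (toWeakSpace ℝ X '' S) := by
  have hcl := hS.toWeakSpace_closure ℝ
  rw [hc.closure_eq] at hcl
  rw [hcl]
  refine NormedSpace.isCompact_closure_of_isBounded ℝ X _ ?_ fun φ _ => ?_
  · rwa [preimage_image_eq _ (toWeakSpace ℝ X).injective]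
  -- Reflexivity enters here: every weak-star limit in the bidual comes from a point of `X`.
  · obtain ⟨x, hx⟩ := hX (WeakDual.toStrongDual φ)
    exact ⟨toWeakSpace ℝ X x, WeakDual.toStrongDual.injective hx⟩

/-- A convex lower semicontinuous function on a nonempty bounded closed convex subset of a
reflexive space attains its minimum. -/
theorem IsReflexiveSpace.exists_isMinOn {X : Type*} [NormedAddCommGroup X]
    [NormedSpace ℝ X] (hX : IsReflexiveSpace X) {S : Set X} (hne : S.Nonempty)
    (hc : IsClosed S) (hb : Bornology.IsBounded S) {f : X → ℝ} (hf : ConvexOn ℝ S f)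
    (hlsc : LowerSemicontinuousOn f S) : ∃ x ∈ S, IsMinOn f S x := by
  have hlscw : LowerSemicontinuousOn (fun z => f ((toWeakSpace ℝ X).symm z))
      (toWeakSpace ℝ X '' S) := by
    rintro _ ⟨x, hx, rfl⟩ c hcx
    -- The sublevel set is a slice of the closed epigraph; being convex as well, it is weakly
    -- closed.
    have hclosed : IsClosed {u | u ∈ S ∧ f u ≤ c} := by
      have := (lowerSemicontinuousOn_iff_isClosed_epigraph hc).1 hlsc
      exact this.preimage (Continuous.prodMk_left c)
    have hw := (hf.convex_le c).toWeakSpace_closure ℝ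
    rw [hclosed.closure_eq] at hw
    have hx' : toWeakSpace ℝ X x ∈ (toWeakSpace ℝ X '' {u | u ∈ S ∧ f u ≤ c})ᶜ := by
      rw [mem_compl_iff, (toWeakSpace ℝ X).injective.mem_set_image]
      have hcx' : c < f x := hcx
      exact fun h => hcx'.not_ge h.2
    rw [hw] at hx'
    filter_upwards [mem_nhdsWithin_of_mem_nhds (isClosed_closure.isOpen_compl.mem_nhds hx'),
      self_mem_nhdsWithin] with z hz hzS
    obtain ⟨u, hu, rfl⟩ := hzS
    rw [← hw, mem_compl_iff, (toWeakSpace ℝ X).injective.mem_set_image] at hz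
    exact lt_of_not_ge fun hle => hz ⟨hu, hle⟩
  obtain ⟨_, ⟨x, hx, rfl⟩, hmin⟩ := hlscw.exists_isMinOn (hne.image _)
    (hX.isCompact_toWeakSpace_image hf.1 hc hb)
  refine ⟨x, hx, fun y hy => ?_⟩
  simpa using hmin (mem_image_of_mem (toWeakSpace ℝ X) hy)

/-- A pointed cone with nonempty interior in a nontrivial space does not contain the origin in its
interior. -/
theorem zero_notMem_interior_of_inter_neg {Z : Type*} [AddCommGroup Z] [Module ℝ Z]
    [TopologicalSpace Z] [ContinuousSMul ℝ Z] [Nontrivial Z]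
    {C : PointedCone ℝ Z} (hC : (C : Set Z) ∩ -(C : Set Z) = {0}) :
    (0 : Z) ∉ interior (C : Set Z) := by
  intro h0
  obtain ⟨z, hz⟩ := exists_ne (0 : Z)
  have hcont : Continuous fun t : ℝ => t • z := by fun_prop
  have hcont' : Continuous fun t : ℝ => t • -z := by fun_prop
  have hnhds : (C : Set Z) ∈ 𝓝 (0 : Z) := mem_interior_iff_mem_nhds.1 h0
  have h1 : ∀ᶠ t : ℝ in 𝓝 0, t • z ∈ (C : Set Z) := hcont.tendsto' 0 0 (zero_smul ..) hnhds
  have h2 : ∀ᶠ t : ℝ in 𝓝 0, t • -z ∈ (C : Set Z) := hcont'.tendsto' 0 0 (zero_smul ..) hnhds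
  obtain ⟨t, ⟨ht1, ht2⟩, ht⟩ :=
    ((h1.and h2).filter_mono nhdsWithin_le_nhds |>.and
      (self_mem_nhdsWithin : Ioi (0 : ℝ) ∈ 𝓝[>] 0)).exists
  have : t • z ∈ (C : Set Z) ∩ -(C : Set Z) := ⟨ht1, by simpa using ht2⟩
  rw [hC, mem_singleton_iff, smul_eq_zero] at this
  exact this.elim (ne_of_gt ht) hz

/-- A pointed cone with nonempty interior has a continuous functional that is nonnegative on the
cone and positive on its interior. -/
theorem exists_positive_functional {Z : Type*} [AddCommGroup Z] [Module ℝ Z]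
    [TopologicalSpace Z] [IsTopologicalAddGroup Z] [ContinuousSMul ℝ Z] [Nontrivial Z]
    {C : PointedCone ℝ Z} (hC : (C : Set Z) ∩ -(C : Set Z) = {0})
    (hint : (interior (C : Set Z)).Nonempty) :
    ∃ g : StrongDual ℝ Z, (∀ c ∈ C, 0 ≤ g c) ∧ ∀ c ∈ interior (C : Set Z), 0 < g c := by
  have hconv : Convex ℝ (C : Set Z) := PointedCone.convex C
  obtain ⟨g, hg⟩ := geometric_hahn_banach_point_open hconv.interior isOpen_interior
    (zero_notMem_interior_of_inter_neg hC)
  rw [map_zero] at hg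
  refine ⟨g, fun c hc => ?_, hg⟩
  -- `C` lies in the closure of its interior, so nonnegativity of `g` extends from `int C` to `C`.
  have hcl : closure (interior (C : Set Z)) ⊆ {z | 0 ≤ g z} :=
    closure_minimal (fun z hz => (hg z hz).le) (isClosed_le continuous_const g.continuous)
  apply hcl
  rw [hconv.closure_interior_eq_closure_of_nonempty_interior hint]
  exact subset_closure hc

/-- Subtracting an element of `C` can only lower `g`, so the half-space `{g < c}` absorbs the `- C`
in the definition. -/
theorem ConeUpperSemicontinuousAt.upperSemicontinuousWithinAt {X Z : Type*} [TopologicalSpace X]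
    [AddCommGroup Z] [Module ℝ Z] [TopologicalSpace Z] {C : PointedCone ℝ Z} {K : Set X}
    {F : X → Z} {x : X} (h : ConeUpperSemicontinuousAt C K F x) {g : StrongDual ℝ Z}
    (hg : ∀ c ∈ C, 0 ≤ g c) : UpperSemicontinuousWithinAt (fun u => g (F u)) K x := by
  intro c hc
  obtain ⟨U, hU, hUK⟩ := h {z | g z < c} ((isOpen_lt g.continuous continuous_const).mem_nhds hc)
  filter_upwards [mem_nhdsWithin_of_mem_nhds hU, self_mem_nhdsWithin] with u hu huK
  obtain ⟨v, hv, w, hw, hvw⟩ := hUK u ⟨hu, huK⟩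
  have hw' := hg w hw
  have hv' : g v < c := hv
  rw [← hvw]
  simp only [map_sub]
  linarith

theorem ConeLowerSemicontinuousAt.lowerSemicontinuousWithinAt {X Z : Type*} [TopologicalSpace X]
    [AddCommGroup Z] [Module ℝ Z] [TopologicalSpace Z] {C : PointedCone ℝ Z} {K : Set X}
    {F : X → Z} {x : X} (h : ConeLowerSemicontinuousAt C K F x) {g : StrongDual ℝ Z}
    (hg : ∀ c ∈ C, 0 ≤ g c) : LowerSemicontinuousWithinAt (fun u => g (F u)) K x := by
  intro c hc
  have := ConeUpperSemicontinuousAt.upperSemicontinuousWithinAt h hg (-c) (by simpa using hc)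
  filter_upwards [this] with u hu
  simpa using hu

theorem mainTheorem9
    {X : Type*} [NormedAddCommGroup X] [NormedSpace ℝ X] [CompleteSpace X]
    (hX : IsReflexiveSpace X)
    {Z : Type*} [AddCommGroup Z] [Module ℝ Z] [TopologicalSpace Z] [IsTopologicalAddGroup Z]
    [ContinuousSMul ℝ Z] [LocallyConvexSpace ℝ Z] [T2Space Z] [Nontrivial Z]
    (C : PointedCone ℝ Z) (hCpointed : (C : Set Z) ∩ -(C : Set Z) = {0})
    (hCint : (interior (C : Set Z)).Nonempty)
    (K : Set X) (hKne : K.Nonempty) (hKconv : Convex ℝ K) (hKclosed : IsClosed K)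
    (D : Set X) (hD : IsWeaklySelfSegmentDense D K)
    (F : X → Z)
    (hlsc : ∀ x ∈ K, ConeLowerSemicontinuousAt C K F x)
    (husc : ∀ x ∈ K \ D, ConeUpperSemicontinuousAt C K F x)
    (hconv : ConeConvexOn C D F)
    (hcoer : ∃ r : ℝ, 0 < r ∧ (∃ x ∈ K, ‖x‖ ≤ r) ∧
      ∀ x ∈ K, ‖x‖ ≤ r →
        ∃ y₀ ∈ D, ‖y₀‖ < r ∧ F y₀ - F x ∈ -interior (C : Set Z) ∪ {0}) :
    ∃ x₀ : X, IsWeaklyEfficientPoint C K F x₀ := by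
  obtain ⟨g, hg, hgint⟩ := exists_positive_functional hCpointed hCint
  obtain ⟨r, -, ⟨x₁, hx₁, hx₁r⟩, hr⟩ := hcoer
  have hf_lsc : LowerSemicontinuousOn (fun u => g (F u)) K :=
    fun x hx => (hlsc x hx).lowerSemicontinuousWithinAt hg
  have hf : ConvexOn ℝ K fun u => g (F u) := by
    refine hD.convexOn hKconv hKclosed hf_lsc
      (fun x hx => (husc x hx).upperSemicontinuousWithinAt hg) fun x hx y hy s hs hmem => ?_
    rw [AffineMap.lineMap_apply_module] at hmem ⊢
    have hC := hconv 2 ![x, y] ![1 - s, s] (by simp [Fin.forall_fin_two, hx, hy])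
      (by simp [Fin.forall_fin_two, hs.1, hs.2]) (by simp) (by simpa using hmem)
    have := hg _ hC
    simp only [Fin.sum_univ_two, Matrix.cons_val_zero, Matrix.cons_val_one, map_sub, map_add,
      map_smul] at this
    rw [AffineMap.lineMap_apply_module]
    linarith
  have hsub : K ∩ closedBall 0 r ⊆ K := inter_subset_left
  obtain ⟨x₀, hx₀, hmin⟩ := hX.exists_isMinOn (S := K ∩ closedBall 0 r)
    ⟨x₁, hx₁, by simpa using hx₁r⟩ (hKclosed.inter isClosed_closedBall)
    (isBounded_closedBall.subset inter_subset_right)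
    (hf.subset hsub (hKconv.inter (convex_closedBall 0 r))) (hf_lsc.mono hsub)
  obtain ⟨y₀, hy₀, hy₀r, hle⟩ := hr x₀ hx₀.1 (by simpa using hx₀.2)
  have hle' : g (F y₀) ≤ g (F x₀) := by
    rcases hle with hle | hle
    · have := hgint _ hle
      rw [map_neg, map_sub] at this
      linarith
    · rw [sub_eq_zero.1 hle]
  -- The strict bound `‖y₀‖ < r` makes the closed ball a neighbourhood of `y₀`, which `x₀` itself,
  -- possibly on the sphere, need not have.
  have hlocal : IsLocalMinOn (fun u => g (F u)) K y₀ := by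
    filter_upwards [self_mem_nhdsWithin, mem_nhdsWithin_of_mem_nhds
      (closedBall_mem_nhds_of_mem (mem_ball_zero_iff.2 hy₀r))] with u hu hur
    exact hle'.trans (hmin ⟨hu, hur⟩)
  have hglobal := IsMinOn.of_isLocalMinOn_of_convexOn (hD.subset hy₀) hlocal hf
  refine ⟨x₀, hx₀.1, fun y hy hneg => ?_⟩
  have h1 : g (F y₀) ≤ g (F y) := hglobal hy
  -- Thus `x₀` is a global minimizer too, whereas `hneg` would give `g (F y) < g (F x₀)`.
  have h2 : g (F x₀) ≤ g (F y₀) := by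
    refine hmin ⟨hD.subset hy₀, ?_⟩
    simpa using hy₀r.le
  have h3 := hgint _ hneg
  rw [map_neg, map_sub] at h3
  linarith
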